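/- For a partition $\lambda$ (the empty partition, of size $0$, included), the hook length of a box of its Young diagram is the number of boxes directly to its right plus the number of boxes directly below it plus $1$. For a set $T$ of positive integers, $\lambda$ is a simultaneous $T$-core if no box of $\lambda$ has hook length in $T$. For integers $s,t\ge 1$, an $s \pmod t$-core is a simultaneous $\{s,s+t,s+2t,\dots\}$-core (also when $s\ge t$, so that only the lengths $s+kt$ with $k\ge 0$ are avoided). Let $c_{s(t)}(n)$ be the number of $s\pmod t$-cores of size $n$, let $C_{s(t)}(q)=\sum_{n\ge 0}c_{s(t)}(n)q^n$, and let $(A;q)_\infty=\prod_{n\ge 0}(1-Aq^n)$. All series and products are formal power series in $q$. Theorem. For every integer $m\ge 0$, $$C_{4(4m+2)}(q)=\frac{(q^2;q^2)_\infty^2}{(q;q)_\infty}\left(\sum_{k=0}^{m+1}q^{k^2+k}\right)^2=\left(\sum_{n=0}^\infty q^{\binom{n+1}{2}}\right)\left(\sum_{k=0}^{m+1}q^{2\binom{k+1}{2}}\right)^2 .$$ Moreover, a partition is a $4\pmod{4m+2}$-core if and only if it is a simultaneous $(4,4m+6)$-core, that is, it has no hook of length $4$ and none of length $4m+6$. 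-/

import Mathlib

open PowerSeries
open scoped PowerSeries.WithPiTopology

/-- The Young diagram of a partition `p` of `n`: row `i` has as many boxes as the `i`-th largest
part of `p`. -/
def Nat.Partition.toYoungDiagram {n : ℕ} (p : n.Partition) : YoungDiagram :=
  YoungDiagram.ofRowLens (p.parts.sort (· ≥ ·)) (Multiset.pairwise_sort p.parts (· ≥ ·)).sortedGE

/-- The hook length of the box `c = (i, j)` (row `i`, column `j`, both counted from `0`): the number
of boxes of row `i` to the right of `c`, plus the number of boxes of column `j` below `c`, plus `1`
for the box itself. It is only used for boxes `c ∈ μ`, where no subtraction truncates. -/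
def YoungDiagram.hookLength (μ : YoungDiagram) (c : ℕ × ℕ) : ℕ :=
  (μ.rowLen c.1 - (c.2 + 1)) + (μ.colLen c.2 - (c.1 + 1)) + 1

/-- `p` is a simultaneous core for the set `T` of lengths: no box of its diagram has a hook length
in `T`. -/
def Nat.Partition.IsSimultaneousCore {n : ℕ} (T : Set ℕ) (p : n.Partition) : Prop :=
  ∀ c ∈ p.toYoungDiagram, p.toYoungDiagram.hookLength c ∉ T

/-- `p` is an `s (mod t)`-core: a simultaneous `(s, s + t, s + 2t, …)`-core. If `s < t`, the avoided
lengths are exactly the naturals congruent to `s` modulo `t`; if `s ≥ t`, the avoided lengths are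
still only those in the progression that starts at `s`. -/
def Nat.Partition.IsModCore {n : ℕ} (s t : ℕ) (p : n.Partition) : Prop :=
  p.IsSimultaneousCore {h : ℕ | ∃ k : ℕ, h = s + k * t}

/-- The number `c_{s(t)}(n)` of `s (mod t)`-cores of size `n`. -/
noncomputable def modCoreCount (s t n : ℕ) : ℕ :=
  Nat.card {p : n.Partition // p.IsModCore s t}

/-- The generating function `C_{s(t)}(q) = ∑ c_{s(t)}(n) q ^ n`, as a formal power series. -/
noncomputable def modCoreGenFun (s t : ℕ) : ℚ⟦X⟧ :=
  PowerSeries.mk fun n => (modCoreCount s t n : ℚ)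

/-- The `q`-Pochhammer symbol `(A; q)_∞ = (1 - A) (1 - A q) (1 - A q ^ 2) ⋯` for formal power
series; the infinite product is taken for coefficientwise convergence. -/
noncomputable def qPochhammerInf (A q : ℚ⟦X⟧) : ℚ⟦X⟧ :=
  ∏' n : ℕ, (1 - A * q ^ n)

/-- The infinite product that defines `(q ^ d; q ^ d)_∞` converges for `d ≥ 1`. -/
theorem qPochhammerInf_multipliable (d : ℕ) (hd : 1 ≤ d) :
    Multipliable fun n : ℕ => (1 - X ^ d * (X ^ d) ^ n : ℚ⟦X⟧) := by
  simp_rw [sub_eq_add_neg]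
  apply PowerSeries.WithPiTopology.multipliable_one_add_of_tendsto_order_atTop_nhds_top
  refine ENat.tendsto_nhds_top_iff_natCast_lt.mpr
    (fun n => Filter.eventually_atTop.mpr ⟨n, fun m hm => ?_⟩)
  rw [order_neg, ← pow_mul, ← pow_add, order_X_pow]
  norm_cast
  nlinarith

/-- `(q ^ d; q ^ d)_∞` has constant coefficient `1` for `d ≥ 1`, so it is invertible. -/
theorem constantCoeff_qPochhammerInf (d : ℕ) (hd : 1 ≤ d) :
    constantCoeff (qPochhammerInf (X ^ d) (X ^ d)) = 1 := by
  have hd' : d ≠ 0 := by omega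
  rw [qPochhammerInf, (qPochhammerInf_multipliable d hd).map_tprod _
    (PowerSeries.WithPiTopology.continuous_constantCoeff ℚ)]
  simp [hd']

/-- The series `∑ q ^ (n + 1 choose 2)` over `n ≥ 0` converges coefficientwise. -/
theorem summable_X_pow_choose :
    Summable fun n : ℕ => (X ^ ((n + 1).choose 2) : ℚ⟦X⟧) := by
  apply PowerSeries.WithPiTopology.summable_of_tendsto_order_atTop_nhds_top
  refine ENat.tendsto_nhds_top_iff_natCast_lt.mpr
    (fun n => Filter.eventually_atTop.mpr ⟨n + 1, fun m hm => ?_⟩)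
  rw [order_X_pow]
  norm_cast
  have h : (m + 1).choose 2 = m + m.choose 2 := by
    rw [Nat.choose_succ_succ' m 1, Nat.choose_one_right]
  omega

/-! A diagram is encoded by its Maya diagram, the set of beads `rowLen i - i - 1`. Hook lengths are
the positive differences bead minus gap, so avoiding `h` means that the bead set is closed under `z
↦ z - h` (`hookLength_notMem_iff`). A 4-core is thus a flush 4-runner abacus, given by levels `n 0,
…, n 3` with sum `0`, and its size is `∑ (2 n_r² + r n_r)`.

All lengths `4 + k(4m + 2)` lie in the semigroup generated by `4` and `4m + 6`, so only these two
matter. As `4m + 6 ≡ 2 (mod 4)`, the second one confines `a = n 2 - n 0` and `b = n 3 - n 1` to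
`[-(m+2), m+1]`. With `c = n 0 + n 2`, the size becomes `(2c² - c) + (a² + a) + (b² + b)`, where `a
≡ b ≡ c (mod 2)`. The values `2c² - c` are the triangular numbers, each taken once. The reflection
`a ↦ -1 - a` keeps `a² + a`, flips parity and preserves the interval, so each `k ≤ m + 1` gives
exactly one admissible `a`. Hence cores correspond to triples `(k, l, N)`, and the generating
function factors. Gauss's identity turns the triangular series into the product. -/

/-! ### Gauss's identity for triangular numbers. -/

/-- Shanks' finite form of Gauss's identity for triangular exponents. -/
theorem prod_odd_mul_sum_pow_choose {R : Type*} [CommRing R] (q : R) (n : ℕ) :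
    (∏ j ∈ Finset.range n, (1 - q ^ (2 * j + 1))) *
        ∑ j ∈ Finset.range (2 * n), q ^ (j + 1).choose 2 =
      ∑ s ∈ Finset.range n, (∏ j ∈ Finset.Ico s n, (1 - q ^ (2 * j + 2))) *
        (∏ j ∈ Finset.range s, (1 - q ^ (2 * j + 1))) * q ^ (s * (2 * n + 1)) := by
  induction n with
  | zero => simp
  | succ n ih =>
    -- Passing from `n` to `n + 1` multiplies the partial sums by `1 - q ^ (2n + 1)`, up to a
    -- telescoping boundary term. At `k = n` that term and the new summand `s = n` account for the
    -- two new triangular powers.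
    have htel : ∀ k ≤ n, ∑ s ∈ Finset.range k,
        (∏ j ∈ Finset.Ico s (n + 1), (1 - q ^ (2 * j + 2))) *
          (∏ j ∈ Finset.range s, (1 - q ^ (2 * j + 1))) * q ^ (s * (2 * (n + 1) + 1)) =
        (1 - q ^ (2 * n + 1)) * ∑ s ∈ Finset.range k,
          (∏ j ∈ Finset.Ico s n, (1 - q ^ (2 * j + 2))) *
          (∏ j ∈ Finset.range s, (1 - q ^ (2 * j + 1))) * q ^ (s * (2 * n + 1)) +
        (1 - q ^ (2 * k)) * (∏ j ∈ Finset.Ico k n, (1 - q ^ (2 * j + 2))) *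
          (∏ j ∈ Finset.range k, (1 - q ^ (2 * j + 1))) * q ^ (k * (2 * n + 1)) := by
      intro k hk
      induction k with
      | zero => simp
      | succ k ihk =>
        rw [Finset.sum_range_succ, Finset.sum_range_succ, ihk (by omega),
          Finset.prod_Ico_succ_top (by omega), Finset.prod_eq_prod_Ico_succ_bot (show k < n by omega),
          Finset.prod_range_succ]
        ring
    have h1 : (2 * n + 1).choose 2 = n * (2 * n + 1) := by
      rw [Nat.choose_two_right]
      exact Nat.div_eq_of_eq_mul_left two_pos (by simp; ring)
    have h2 : (2 * n + 1 + 1).choose 2 = n * (2 * n + 1) + (2 * n + 1) := by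
      rw [Nat.choose_two_right]
      exact Nat.div_eq_of_eq_mul_left two_pos (by simp; ring)
    rw [Finset.sum_range_succ, htel n le_rfl, ← ih, Finset.prod_range_succ, Nat.mul_succ,
      Finset.sum_range_succ, Finset.sum_range_succ, h1, h2, Finset.prod_Ico_succ_top le_rfl]
    simp only [Finset.Ico_self, Finset.prod_empty]
    ring

/-- Gauss's product formula for the generating function of the triangular numbers. -/
theorem qPochhammerInf_mul_tsum_X_pow_choose :
    qPochhammerInf X X * ∑' n : ℕ, (X : ℚ⟦X⟧) ^ (n + 1).choose 2 =
      qPochhammerInf (X ^ 2) (X ^ 2) ^ 2 := by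
  have hX : Filter.Tendsto (fun n : ℕ => ∏ j ∈ Finset.range n, (1 - X * X ^ j : ℚ⟦X⟧))
      Filter.atTop (nhds (qPochhammerInf X X)) := by
    simpa [qPochhammerInf] using (qPochhammerInf_multipliable 1 le_rfl).hasProd.tendsto_prod_nat
  have hX2 := (qPochhammerInf_multipliable 2 one_le_two).hasProd.tendsto_prod_nat
  have hs := summable_X_pow_choose.hasSum.tendsto_sum_nat
  have hmul : Filter.Tendsto (fun n : ℕ => 2 * n) Filter.atTop Filter.atTop :=
    Filter.tendsto_atTop_mono (fun n => Nat.le_mul_of_pos_left n two_pos) Filter.tendsto_id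
  -- Both factors are taken along the even indices `2n`, where the finite identity applies.
  refine tendsto_nhds_unique ((hX.comp hmul).mul (hs.comp hmul)) ?_
  have hfin : ∀ n : ℕ, ∃ g : ℚ⟦X⟧,
      (∏ j ∈ Finset.range (2 * n), (1 - X * X ^ j : ℚ⟦X⟧)) *
        ∑ j ∈ Finset.range (2 * n), (X : ℚ⟦X⟧) ^ (j + 1).choose 2 =
      (∏ j ∈ Finset.range n, (1 - X ^ 2 * (X ^ 2) ^ j : ℚ⟦X⟧)) ^ 2 + X ^ n * g := by
    intro n
    have hprod : ∏ j ∈ Finset.range (2 * n), (1 - X * X ^ j : ℚ⟦X⟧) =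
        (∏ j ∈ Finset.range n, (1 - X ^ 2 * (X ^ 2) ^ j : ℚ⟦X⟧)) *
          ∏ j ∈ Finset.range n, (1 - X ^ (2 * j + 1) : ℚ⟦X⟧) := by
      induction n with
      | zero => simp
      | succ n ih =>
        rw [Nat.mul_succ, Finset.prod_range_succ, Finset.prod_range_succ, ih,
          Finset.prod_range_succ, Finset.prod_range_succ]
        ring
    rw [hprod, mul_assoc, prod_odd_mul_sum_pow_choose]
    rcases n with _ | n
    · exact ⟨-1, by simp⟩
    -- Only the summand `s = 0` survives modulo `X ^ (n + 1)`; it is the second copy of the even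
    -- product.
    · have hdvd : (X : ℚ⟦X⟧) ^ (n + 1) ∣ ∑ s ∈ Finset.range n,
          (∏ j ∈ Finset.Ico (s + 1) (n + 1), (1 - X ^ (2 * j + 2))) *
          (∏ j ∈ Finset.range (s + 1), (1 - X ^ (2 * j + 1))) *
            X ^ ((s + 1) * (2 * (n + 1) + 1)) :=
        Finset.dvd_sum fun s _ => Dvd.dvd.mul_left (pow_dvd_pow _ (by nlinarith)) _
      obtain ⟨g, hg⟩ := hdvd
      refine ⟨(∏ j ∈ Finset.range (n + 1), (1 - X ^ 2 * (X ^ 2) ^ j : ℚ⟦X⟧)) * g, ?_⟩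
      rw [Finset.sum_range_succ', hg, Nat.Ico_zero_eq_range]
      have : ∀ j : ℕ, (1 - X ^ (2 * j + 2) : ℚ⟦X⟧) = 1 - X ^ 2 * (X ^ 2) ^ j := fun j => by ring
      simp only [this, Finset.range_zero, Finset.prod_empty, zero_mul, pow_zero]
      ring
  choose g hg using hfin
  have h0 : Filter.Tendsto (fun n : ℕ => X ^ n * g n) Filter.atTop (nhds 0) := by
    rw [PowerSeries.WithPiTopology.tendsto_iff_coeff_tendsto]
    intro d
    refine tendsto_atTop_of_eventually_const (i₀ := d + 1) fun n hn => ?_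
    rw [coeff_X_pow_mul', if_neg (by omega), map_zero]
  simpa [Function.comp_def, hg, qPochhammerInf] using (hX2.pow 2).add h0

/-! ### Maya diagrams and hook lengths. -/

namespace YoungDiagram

/-- The first-column hook lengths of `μ`, shifted so that they do not depend on the number of
rows. -/
def beta (μ : YoungDiagram) (i : ℕ) : ℤ := μ.rowLen i - i - 1

/-- The Maya diagram of `μ`. -/
def maya (μ : YoungDiagram) : Set ℤ := Set.range μ.beta

theorem beta_strictAnti (μ : YoungDiagram) : StrictAnti μ.beta := fun i j h => by
  have := μ.rowLen_anti i j h.le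
  simp only [beta]
  omega

theorem mem_maya_of_lt {μ : YoungDiagram} {z : ℤ} (hz : z < -μ.colLen 0) : z ∈ μ.maya := by
  refine ⟨(-z - 1).toNat, ?_⟩
  have h : μ.rowLen (-z - 1).toNat = 0 := by
    by_contra h
    have := mem_iff_lt_colLen.1 (mem_iff_lt_rowLen.2 (Nat.pos_of_ne_zero h))
    omega
  simp only [beta, h]
  omega

theorem lt_rowLen_zero_of_mem_maya {μ : YoungDiagram} {z : ℤ} (hz : z ∈ μ.maya) :
    z < μ.rowLen 0 := by
  obtain ⟨i, rfl⟩ := hz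
  have := μ.rowLen_anti 0 i i.zero_le
  simp only [beta]
  omega

theorem lt_rowLen_iff_lt_colLen (μ : YoungDiagram) (i j : ℕ) :
    j < μ.rowLen i ↔ i < μ.colLen j := by
  rw [← mem_iff_lt_rowLen, mem_iff_lt_colLen]

/-- The complement of the Maya diagram is the Maya diagram of the transpose, reflected. -/
theorem notMem_maya_iff {μ : YoungDiagram} {z : ℤ} :
    z ∉ μ.maya ↔ ∃ j : ℕ, z = j - μ.colLen j := by
  constructor
  · intro hz
    have hex : ∃ i, μ.beta i < z := by
      refine ⟨(μ.rowLen 0 - z).toNat, ?_⟩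
      have := μ.rowLen_anti 0 (μ.rowLen 0 - z).toNat (Nat.zero_le _)
      simp only [beta]
      omega
    classical
    -- The gap `z` lies just above bead `i` and below bead `i - 1`, so column `z + i` has length
    -- exactly `i`.
    have hi := Nat.find_spec hex
    have hmin := fun k => Nat.find_min (m := k) hex
    generalize Nat.find hex = i at hi hmin
    have hi' : (μ.rowLen i : ℤ) - i - 1 < z := hi
    have h1 := μ.lt_rowLen_iff_lt_colLen i (z + i).toNat
    refine ⟨(z + i).toNat, ?_⟩
    rcases i with _ | k
    · omega
    · have h2 := μ.lt_rowLen_iff_lt_colLen k (z + (k + 1 : ℕ)).toNat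
      have h3 : ¬ (μ.rowLen k : ℤ) - k - 1 < z := hmin k k.lt_succ_self
      have h4 : (μ.rowLen k : ℤ) - k - 1 ≠ z := fun h => hz ⟨k, h⟩
      omega
  · rintro ⟨j, rfl⟩ ⟨i, hi⟩
    have := μ.lt_rowLen_iff_lt_colLen i j
    simp only [beta] at hi
    omega

theorem hookLength_eq {μ : YoungDiagram} {i j : ℕ} (h : (i, j) ∈ μ) :
    (μ.hookLength (i, j) : ℤ) = μ.beta i - (j - μ.colLen j) := by
  have h1 := mem_iff_lt_rowLen.1 h
  have h2 := mem_iff_lt_colLen.1 h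
  simp only [hookLength, beta]
  omega

/-- A bead of row `i` lies above the gap of column `j` exactly when `(i, j)` is a box, and the
difference is then its hook length. -/
theorem hookLength_notMem_iff {μ : YoungDiagram} {T : Set ℕ} (hT : 0 ∉ T) :
    (∀ c ∈ μ, μ.hookLength c ∉ T) ↔ ∀ h ∈ T, ∀ z ∈ μ.maya, z - h ∈ μ.maya := by
  constructor
  · rintro H h hh z ⟨i, rfl⟩
    by_contra hz
    obtain ⟨j, hj⟩ := notMem_maya_iff.1 hz
    have hpos : h ≠ 0 := fun h0 => hT (h0 ▸ hh)
    have hmem : (i, j) ∈ μ := by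
      have := μ.lt_rowLen_iff_lt_colLen i j
      rw [mem_iff_lt_rowLen]
      simp only [beta] at hj
      omega
    have := hookLength_eq hmem
    refine H _ hmem ?_
    rwa [show μ.hookLength (i, j) = h by omega]
  · rintro H ⟨i, j⟩ hc hh
    have := H _ hh _ ⟨i, rfl⟩
    rw [hookLength_eq hc, sub_sub_cancel] at this
    exact notMem_maya_iff.2 ⟨j, rfl⟩ this

/-- A strictly monotone sequence is determined by its range; the negation makes `beta` increasing.
-/
theorem maya_injective : Function.Injective maya := by
  intro μ ν h
  have hβ : (fun i => -μ.beta i) = fun i => -ν.beta i := by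
    refine (StrictMono.range_inj μ.beta_strictAnti.neg ν.beta_strictAnti.neg).1 ?_
    have hr : ∀ ρ : YoungDiagram, Set.range (fun i => -ρ.beta i) = Neg.neg '' ρ.maya := fun ρ =>
      Set.range_comp Neg.neg ρ.beta
    exact (hr μ).trans (h ▸ (hr ν).symm)
  ext ⟨i, j⟩
  have := congrFun hβ i
  simp only [beta] at this
  rw [mem_cells, mem_cells, mem_iff_lt_rowLen, mem_iff_lt_rowLen]
  omega

/-- Sums over the top part of the Maya diagram run over the rows of the diagram. -/
theorem sum_beta {μ : YoungDiagram} {L : ℕ} (hL : μ.colLen 0 ≤ L) {T : Finset ℤ}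
    (hT : ∀ z, z ∈ T ↔ z ∈ μ.maya ∧ -(L : ℤ) ≤ z) (f : ℤ → ℤ) :
    ∑ i ∈ Finset.range L, f (μ.beta i) = ∑ z ∈ T, f z := by
  have : T = (Finset.range L).image μ.beta := by
    ext z
    rw [hT, Finset.mem_image]
    constructor
    · rintro ⟨⟨i, rfl⟩, hi⟩
      refine ⟨i, Finset.mem_range.2 ?_, rfl⟩
      have := μ.lt_rowLen_iff_lt_colLen i 0
      simp only [beta] at hi
      omega
    · rintro ⟨i, hi, rfl⟩
      have := Finset.mem_range.1 hi
      refine ⟨⟨i, rfl⟩, ?_⟩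
      simp only [beta]
      omega
  rw [this, Finset.sum_image μ.beta_strictAnti.injective.injOn]

theorem sum_rowLen {μ : YoungDiagram} {L : ℕ} (hL : μ.colLen 0 ≤ L) :
    ∑ i ∈ Finset.range L, μ.rowLen i = μ.rowLens.sum := by
  have : μ.rowLens.sum = ∑ i ∈ Finset.range (μ.colLen 0), μ.rowLen i := rfl
  rw [this]
  refine (Finset.sum_subset (Finset.range_mono hL) fun i _ hi => ?_).symm
  have := μ.lt_rowLen_iff_lt_colLen i 0
  rw [Finset.mem_range] at hi
  omega

theorem exists_rowLen_eq {f : ℕ → ℕ} (hf : Antitone f) {L : ℕ} (hL : ∀ i, L ≤ i → f i = 0) :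
    ∃ μ : YoungDiagram, ∀ i, μ.rowLen i = f i := by
  refine ⟨ofRowLens ((List.range L).map f)
    (List.Pairwise.map (R := (· ≤ ·)) (S := (· ≥ ·)) f (fun _ _ h => hf h) List.pairwise_le_range).sortedGE, fun i => ?_⟩
  refine eq_of_forall_lt_iff fun j => ?_
  rw [← mem_iff_lt_rowLen, mem_ofRowLens]
  by_cases hi : i < L
  · simp [hi]
  · simp [hi, hL i (not_lt.1 hi)]

/-- A set of `L` integers that are at least `-L` is the top part of a Maya diagram. -/
theorem exists_maya_eq {T : Finset ℤ} (hT : ∀ z ∈ T, -(T.card : ℤ) ≤ z) :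
    ∃ μ : YoungDiagram, ∀ z, z ∈ μ.maya ↔ z ∈ T ∨ z < -T.card := by
  generalize hL : T.card = L at hT
  set e := T.orderEmbOfFin hL
  -- This bound makes the row lengths below nonnegative, so that `toNat` loses nothing.
  have hlow : ∀ k (hk : k < L), (k : ℤ) - L ≤ e ⟨k, hk⟩ := by
    intro k
    induction k with
    | zero => exact fun hk => by simpa using hT _ (T.orderEmbOfFin_mem hL ⟨0, hk⟩)
    | succ k ih =>
      intro hk
      have h1 := ih (by omega)
      have h2 : e ⟨k, by omega⟩ < e ⟨k + 1, hk⟩ := e.strictMono (by simp)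
      push_cast
      omega
  let f : ℕ → ℕ := fun i =>
    if h : i < L then (e ⟨L - 1 - i, by omega⟩ + i + 1).toNat else 0
  have hfv : ∀ i (h : i < L), (f i : ℤ) = e ⟨L - 1 - i, by omega⟩ + i + 1 := by
    intro i h
    have := hlow (L - 1 - i) (by omega)
    simp only [f, dif_pos h]
    omega
  have hf0 : ∀ i, L ≤ i → f i = 0 := fun i hi => dif_neg (by omega)
  have hf : Antitone f := by
    refine antitone_nat_of_succ_le fun i => ?_
    by_cases h : i + 1 < L
    · have h1 := hfv i (by omega)
      have h2 := hfv (i + 1) h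
      have h3 : e ⟨L - 1 - (i + 1), by omega⟩ < e ⟨L - 1 - i, by omega⟩ :=
        e.strictMono (by simp only [Fin.mk_lt_mk]; omega)
      push_cast at h2
      omega
    · simp [hf0 (i + 1) (by omega)]
  obtain ⟨μ, hμ⟩ := exists_rowLen_eq hf hf0
  refine ⟨μ, fun z => ⟨?_, ?_⟩⟩
  · rintro ⟨i, rfl⟩
    simp only [beta, hμ]
    by_cases h : i < L
    · left
      rw [hfv i h]
      convert T.orderEmbOfFin_mem hL ⟨L - 1 - i, by omega⟩ using 1
      ring
    · right
      rw [hf0 i (by omega)]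
      omega
  · rintro (hz | hz)
    · have : z ∈ Set.range e := by rw [T.range_orderEmbOfFin hL]; exact hz
      obtain ⟨⟨k, hk⟩, rfl⟩ := this
      refine ⟨L - 1 - k, ?_⟩
      simp only [beta, hμ]
      rw [hfv _ (by omega)]
      have : L - 1 - (L - 1 - k) = k := by omega
      simp only [this]
      ring
    · refine ⟨(-z - 1).toNat, ?_⟩
      simp only [beta, hμ]
      rw [hf0 _ (by omega)]
      omega

end YoungDiagram

/-! ### Partitions and their diagrams. -/

namespace Nat.Partition

theorem rowLens_toYoungDiagram {n : ℕ} (p : n.Partition) :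
    p.toYoungDiagram.rowLens = p.parts.sort (· ≥ ·) :=
  YoungDiagram.rowLens_ofRowLens_eq_self fun _ hx => p.parts_pos ((Multiset.mem_sort _).1 hx)

theorem sum_rowLens_toYoungDiagram {n : ℕ} (p : n.Partition) :
    p.toYoungDiagram.rowLens.sum = n := by
  rw [rowLens_toYoungDiagram, ← Multiset.sum_coe, Multiset.sort_eq, p.parts_sum]

theorem toYoungDiagram_injective {n : ℕ} :
    Function.Injective (toYoungDiagram : n.Partition → YoungDiagram) := by
  intro p q h
  ext1
  rw [← p.parts.sort_eq (· ≥ ·), ← rowLens_toYoungDiagram, h, rowLens_toYoungDiagram,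
    Multiset.sort_eq]

theorem exists_toYoungDiagram_eq {n : ℕ} {μ : YoungDiagram} (h : μ.rowLens.sum = n) :
    ∃ p : n.Partition, p.toYoungDiagram = μ := by
  refine ⟨⟨μ.rowLens, fun {i} hi => μ.pos_of_mem_rowLens i hi, by simpa using h⟩, ?_⟩
  refine YoungDiagram.equivListRowLens.injective (Subtype.ext ?_)
  simp only [YoungDiagram.equivListRowLens_apply_coe, rowLens_toYoungDiagram]
  rw [Multiset.coe_sort]
  exact List.mergeSort_of_pairwise (by simpa using μ.rowLens_sorted.pairwise)

end Nat.Partition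

/-! ### Flush abaci and their bead sums. -/

/-- The set of positions occupied on a `t`-runner abacus whose runner `r` is filled below level
`n r`. -/
def flushAbacus {t : ℕ} (n : Fin t → ℤ) : Set ℤ := {z | ∃ r : Fin t, ∃ x < n r, z = t * x + r}

theorem runner_unique {t : ℕ} {r s : Fin t} {x y : ℤ} (h : (t : ℤ) * x + r = t * y + s) :
    r = s ∧ x = y := by
  have hr : ((t : ℤ) * x + r) % t = r := by
    rw [Int.mul_add_emod_self_left, Int.emod_eq_of_lt (by omega) (by omega)]
  have hs : ((t : ℤ) * y + s) % t = s := by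
    rw [Int.mul_add_emod_self_left, Int.emod_eq_of_lt (by omega) (by omega)]
  have hrs : (r : ℤ) = s := by rw [← hr, ← hs, h]
  have hxy : (t : ℤ) * x = t * y := by omega
  refine ⟨Fin.ext (by omega), mul_left_cancel₀ ?_ hxy⟩
  have := r.pos
  omega

theorem exists_runner {t : ℕ} (ht : 0 < t) (z : ℤ) : ∃ (r : Fin t) (x : ℤ), z = t * x + r := by
  have h0 := Int.emod_nonneg z (show (t : ℤ) ≠ 0 by omega)
  have h1 := Int.emod_lt_of_pos z (show (0 : ℤ) < t by omega)
  refine ⟨⟨(z % t).toNat, by omega⟩, z / t, ?_⟩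
  have := Int.mul_ediv_add_emod z t
  simp only
  omega

theorem mem_flushAbacus {t : ℕ} {n : Fin t → ℤ} {r : Fin t} {x : ℤ} :
    (t : ℤ) * x + r ∈ flushAbacus n ↔ x < n r := by
  constructor
  · rintro ⟨s, y, hy, h⟩
    obtain ⟨rfl, rfl⟩ := runner_unique h
    exact hy
  · exact fun h => ⟨r, x, h, rfl⟩

theorem flushAbacus_injective {t : ℕ} :
    Function.Injective (flushAbacus : (Fin t → ℤ) → Set ℤ) := by
  intro m n h
  ext r
  refine eq_of_forall_lt_iff fun x => ?_
  rw [← mem_flushAbacus, h, mem_flushAbacus]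

theorem sub_mem_flushAbacus {t : ℕ} {n : Fin t → ℤ} {z : ℤ} (hz : z ∈ flushAbacus n) (k : ℕ) :
    z - t * k ∈ flushAbacus n := by
  obtain ⟨r, x, hx, rfl⟩ := hz
  exact ⟨r, x - k, by omega, by ring⟩

/-- The part of an abacus from level `-K` upwards. -/
noncomputable def abacusTop {t : ℕ} (n : Fin t → ℤ) (K : ℕ) : Finset ℤ :=
  (Finset.univ.sigma fun r => Finset.Ico (-K : ℤ) (n r)).image fun p => t * p.2 + p.1

theorem mem_abacusTop {t : ℕ} {n : Fin t → ℤ} {K : ℕ} {z : ℤ} :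
    z ∈ abacusTop n K ↔ z ∈ flushAbacus n ∧ -((t * K : ℕ) : ℤ) ≤ z := by
  simp only [abacusTop, Finset.mem_image, Finset.mem_sigma, Finset.mem_univ, true_and,
    Finset.mem_Ico, Sigma.exists]
  constructor
  · rintro ⟨r, x, ⟨hK, hx⟩, rfl⟩
    refine ⟨⟨r, x, hx, rfl⟩, ?_⟩
    push_cast
    nlinarith
  · rintro ⟨⟨r, x, hx, rfl⟩, hz⟩
    refine ⟨r, x, ⟨?_, hx⟩, rfl⟩
    push_cast at hz
    by_contra h
    have := r.2
    nlinarith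

theorem sum_abacusTop {t : ℕ} (n : Fin t → ℤ) (K : ℕ) (f : ℤ → ℤ) :
    ∑ z ∈ abacusTop n K, f z = ∑ r, ∑ x ∈ Finset.Ico (-K : ℤ) (n r), f (t * x + r) := by
  rw [abacusTop, Finset.sum_image, Finset.sum_sigma]
  rintro ⟨r, x⟩ - ⟨s, y⟩ - h
  obtain ⟨rfl, rfl⟩ := runner_unique h
  rfl

theorem card_abacusTop {t : ℕ} {n : Fin t → ℤ} {K : ℕ} (hK : ∀ r, -(K : ℤ) ≤ n r) :
    ((abacusTop n K).card : ℤ) = ∑ r, n r + t * K := by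
  have h := sum_abacusTop n K fun _ => 1
  have h1 : ∀ r, ∑ x ∈ Finset.Ico (-K : ℤ) (n r), (1 : ℤ) = n r + K := fun r => by
    have := hK r
    simp only [Finset.sum_const, Int.card_Ico, nsmul_eq_mul, mul_one]
    omega
  simp only [h1, Finset.sum_add_distrib] at h
  simpa using h

theorem two_mul_sum_Ico_id {a b : ℤ} (h : a ≤ b) :
    2 * ∑ x ∈ Finset.Ico a b, x = (b - a) * (a + b - 1) := by
  induction b, h using Int.leInduction with
  | base => simp
  | succ b hb ih =>
    rw [← Finset.insert_Ico_right_eq_Ico_add_one hb, Finset.sum_insert (by simp), mul_add, ih]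
    ring

theorem two_mul_sum_abacusTop {t : ℕ} {n : Fin t → ℤ} {K : ℕ} (hK : ∀ r, -(K : ℤ) ≤ n r) :
    2 * ∑ z ∈ abacusTop n K, z =
      ∑ r : Fin t, (t * ((n r + K) * (n r - K - 1)) + 2 * r * (n r + K)) := by
  have h := sum_abacusTop n K fun z => z
  rw [h, Finset.mul_sum]
  refine Finset.sum_congr rfl fun r _ => ?_
  have h1 := two_mul_sum_Ico_id (hK r)
  have h2 : ((Finset.Ico (-K : ℤ) (n r)).card : ℤ) = n r + K := by
    have := hK r
    rw [Int.card_Ico]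
    omega
  rw [Finset.sum_add_distrib, ← Finset.mul_sum, Finset.sum_const, nsmul_eq_mul, h2, mul_add,
    mul_left_comm, h1]
  ring

theorem exists_neg_le {ι : Type*} [Finite ι] (n : ι → ℤ) (L : ℕ) :
    ∃ K : ℕ, L ≤ K ∧ ∀ r, -(K : ℤ) ≤ n r := by
  obtain ⟨M, hM⟩ := (Set.finite_range fun r => (-n r).toNat).bddAbove
  refine ⟨max L M, le_max_left _ _, fun r => ?_⟩
  have := hM ⟨r, rfl⟩
  have := le_max_right L M
  simp only at *
  omega

/-! ### Cores as balanced flush abaci. -/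

namespace YoungDiagram

/-- The abacus of a diagram is balanced, and it determines the size of the diagram. -/
theorem sum_eq_zero_and_size_of_maya_eq {μ : YoungDiagram} {t : ℕ} (ht : 0 < t) {n : Fin t → ℤ}
    (h : μ.maya = flushAbacus n) :
    ∑ r, n r = 0 ∧ 2 * (μ.rowLens.sum : ℤ) = ∑ r : Fin t, (t * n r ^ 2 + 2 * r * n r) := by
  obtain ⟨K, hLK, hK⟩ := exists_neg_le n (μ.colLen 0)
  have hL : μ.colLen 0 ≤ t * K := hLK.trans (Nat.le_mul_of_pos_left K ht)
  have hT : ∀ z, z ∈ abacusTop n K ↔ z ∈ μ.maya ∧ -((t * K : ℕ) : ℤ) ≤ z := fun z => by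
    rw [h, mem_abacusTop]
  have hcard := card_abacusTop hK
  have h1 := sum_beta hL hT fun _ => 1
  -- The beads from `-tK` upwards number `tK` by rows and `∑ n r + tK` by runners.
  have hsum : ∑ r, n r = 0 := by
    simp only [Finset.sum_const, Finset.card_range, nsmul_eq_mul, mul_one, hcard] at h1
    push_cast at h1
    omega
  refine ⟨hsum, ?_⟩
  have h2 := sum_beta hL hT fun z => z
  have h3 := two_mul_sum_abacusTop hK
  have hrow : ∑ i ∈ Finset.range (t * K), (μ.rowLen i : ℤ) = μ.rowLens.sum := by
    rw [← sum_rowLen hL, Nat.cast_sum]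
  have hgauss : ∀ L : ℕ, 2 * ∑ i ∈ Finset.range L, (i : ℤ) = L * (L - 1) := fun L => by
    induction L with
    | zero => simp
    | succ L ih => rw [Finset.sum_range_succ, mul_add, ih]; push_cast; ring
  have hrun : 2 * ∑ r : Fin t, (r : ℤ) = t * (t - 1) := by
    rw [← hgauss, Fin.sum_univ_eq_sum_range fun i => (i : ℤ)]
  have hg := hgauss (t * K)
  have h4 : ∑ r : Fin t, (t * ((n r + K) * (n r - K - 1)) + 2 * r * (n r + K)) =
      ∑ r : Fin t, (t * n r ^ 2 + 2 * r * n r) + -t * ∑ r, n r + 2 * K * ∑ r : Fin t, (r : ℤ) +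
        t * (-(t * K * (K + 1))) := by
    rw [Finset.mul_sum, Finset.mul_sum, ← Finset.sum_add_distrib, ← Finset.sum_add_distrib]
    have : (t : ℤ) * (-(t * K * (K + 1))) = ∑ _r : Fin t, -((t : ℤ) * K * (K + 1)) := by simp
    rw [this, ← Finset.sum_add_distrib]
    exact Finset.sum_congr rfl fun r _ => by ring
  simp only [beta, Finset.sum_sub_distrib, hrow, Finset.sum_const, Finset.card_range, nsmul_eq_mul,
    mul_one] at h2
  rw [← h2, h4, hsum] at h3
  rw [Nat.cast_mul] at h3 hg
  linear_combination h3 + hg + K * hrun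

theorem exists_maya_eq_flushAbacus {t : ℕ} (ht : 0 < t) {n : Fin t → ℤ} (hn : ∑ r, n r = 0) :
    ∃ μ : YoungDiagram, μ.maya = flushAbacus n := by
  obtain ⟨K, -, hK⟩ := exists_neg_le n 0
  have hcard : (abacusTop n K).card = t * K := by
    have := card_abacusTop hK
    rw [hn, zero_add] at this
    exact_mod_cast this
  obtain ⟨μ, hμ⟩ := exists_maya_eq (T := abacusTop n K) fun z hz => by
    rw [hcard]; exact (mem_abacusTop.1 hz).2
  refine ⟨μ, Set.ext fun z => ?_⟩
  rw [hμ, hcard, mem_abacusTop]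
  have : z < -((t * K : ℕ) : ℤ) → z ∈ flushAbacus n := by
    intro hz
    obtain ⟨r, x, rfl⟩ := exists_runner ht z
    rw [mem_flushAbacus]
    refine lt_of_lt_of_le ?_ (hK r)
    push_cast at hz
    by_contra hx
    nlinarith
  by_cases hz : z < -((t * K : ℕ) : ℤ)
  · exact iff_of_true (Or.inr hz) (this hz)
  · exact ⟨fun h => (h.resolve_right hz).1, fun h => Or.inl ⟨h, not_lt.1 hz⟩⟩

/-- Closure under subtracting `t` makes each runner a down-set. It is nonempty and bounded above,
since a Maya diagram contains all very negative integers and no large ones. -/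
theorem sub_mem_maya_iff_exists_flushAbacus {μ : YoungDiagram} {t : ℕ} (ht : 0 < t) :
    (∀ z ∈ μ.maya, z - t ∈ μ.maya) ↔ ∃ n : Fin t → ℤ, μ.maya = flushAbacus n := by
  constructor
  · intro h
    have hdown : ∀ (r : Fin t) (x y : ℤ), y ≤ x → t * x + r ∈ μ.maya → t * y + r ∈ μ.maya := by
      intro r x y hyx
      induction y, hyx using Int.leInductionDown with
      | base => exact id
      | pred y _ ih =>
        intro hx
        convert h _ (ih hx) using 1
        ring
    have hrun : ∀ r : Fin t, ∃ N : ℤ, ∀ x : ℤ, t * x + r ∈ μ.maya ↔ x < N := by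
      intro r
      obtain ⟨N, hN, hmax⟩ := Int.exists_greatest_of_bdd
        (P := fun x : ℤ => (t : ℤ) * x + r ∈ μ.maya)
        ⟨μ.rowLen 0, fun x hx => by
          have := lt_rowLen_zero_of_mem_maya hx
          by_contra hlt
          nlinarith⟩
        ⟨-μ.colLen 0 - 1, mem_maya_of_lt (by have := r.2; nlinarith)⟩
      refine ⟨N + 1, fun x => ⟨fun hx => Int.lt_add_one_of_le (hmax x hx), fun hx => ?_⟩⟩
      exact hdown r N x (Int.le_of_lt_add_one hx) hN
    choose n hn using hrun
    refine ⟨n, Set.ext fun z => ?_⟩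
    obtain ⟨r, x, rfl⟩ := exists_runner ht z
    rw [hn, mem_flushAbacus]
  · rintro ⟨n, hn⟩ z hz
    rw [hn] at hz ⊢
    simpa using sub_mem_flushAbacus hz 1

end YoungDiagram

/-! ### Reduction to the two lengths `4` and `4m + 6`. -/

namespace Nat.Partition

theorem isSimultaneousCore_iff {n : ℕ} {T : Set ℕ} (hT : 0 ∉ T) (p : n.Partition) :
    p.IsSimultaneousCore T ↔
      ∀ h ∈ T, ∀ z ∈ p.toYoungDiagram.maya, z - h ∈ p.toYoungDiagram.maya :=
  YoungDiagram.hookLength_notMem_iff hT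

/-- Every length `4 + k (4 m + 2)` lies in the numerical semigroup generated by `4` and
`4 m + 6`. -/
theorem isModCore_four_iff {n : ℕ} (m : ℕ) (p : n.Partition) :
    p.IsModCore 4 (4 * m + 2) ↔ p.IsSimultaneousCore {4, 4 * m + 6} := by
  constructor
  · intro H c hc h
    refine H c hc ?_
    rcases h with h | h
    · exact ⟨0, by omega⟩
    · exact ⟨1, by rw [Set.mem_singleton_iff] at h; omega⟩
  · have h0 : 0 ∉ {h : ℕ | ∃ k : ℕ, h = 4 + k * (4 * m + 2)} := by
      rintro ⟨k, hk⟩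
      omega
    rw [IsModCore, isSimultaneousCore_iff h0, isSimultaneousCore_iff (by simp)]
    rintro H _ ⟨k, rfl⟩
    obtain ⟨ν, hν⟩ := (YoungDiagram.sub_mem_maya_iff_exists_flushAbacus four_pos).1
      (H 4 (by simp))
    have h4 : ∀ z ∈ p.toYoungDiagram.maya, ∀ k : ℕ, z - 4 * k ∈ p.toYoungDiagram.maya := by
      rw [hν]
      exact fun z hz k => sub_mem_flushAbacus hz k
    have h6 := H (4 * m + 6) (by simp)
    intro z hz
    obtain ⟨j, rfl | rfl⟩ := Nat.even_or_odd' k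
    · convert h4 z hz (1 + j * (2 * m + 1)) using 1
      push_cast
      ring
    · convert h4 _ (h6 z hz) (j * (2 * m + 1)) using 1
      push_cast
      ring

end Nat.Partition

/-- Subtracting `4m + 6` sends runners 0, 1 to 2, 3 down `m + 2` levels, and runners 2, 3 to 0, 1
down `m + 1` levels. Testing the highest bead of each runner suffices. -/
theorem sub_mem_flushAbacus_four_iff {n : Fin 4 → ℤ} (m : ℕ) :
    (∀ z ∈ flushAbacus n, z - (4 * m + 6 : ℕ) ∈ flushAbacus n) ↔
      (n 0 ≤ n 2 + m + 2 ∧ n 2 ≤ n 0 + m + 1) ∧ n 1 ≤ n 3 + m + 2 ∧ n 3 ≤ n 1 + m + 1 := by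
  have e0 : ∀ x : ℤ, 4 * x ∈ flushAbacus n ↔ x < n 0 := fun x => by
    simpa using mem_flushAbacus (n := n) (r := 0) (x := x)
  have e1 : ∀ x : ℤ, 4 * x + 1 ∈ flushAbacus n ↔ x < n 1 := fun x => by
    simpa using mem_flushAbacus (n := n) (r := 1) (x := x)
  have e2 : ∀ x : ℤ, 4 * x + 2 ∈ flushAbacus n ↔ x < n 2 := fun x => by
    simpa using mem_flushAbacus (n := n) (r := 2) (x := x)
  have e3 : ∀ x : ℤ, 4 * x + 3 ∈ flushAbacus n ↔ x < n 3 := fun x => by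
    simpa using mem_flushAbacus (n := n) (r := 3) (x := x)
  have s0 : ∀ x : ℤ, 4 * x - (4 * m + 6 : ℕ) = 4 * (x - m - 2) + 2 := fun x => by
    push_cast; ring
  have s1 : ∀ x : ℤ, 4 * x + 1 - (4 * m + 6 : ℕ) = 4 * (x - m - 2) + 3 := fun x => by
    push_cast; ring
  have s2 : ∀ x : ℤ, 4 * x + 2 - (4 * m + 6 : ℕ) = 4 * (x - m - 1) := fun x => by
    push_cast; ring
  have s3 : ∀ x : ℤ, 4 * x + 3 - (4 * m + 6 : ℕ) = 4 * (x - m - 1) + 1 := fun x => by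
    push_cast; ring
  constructor
  · intro H
    have h0 := H _ ((e0 (n 0 - 1)).2 (by omega))
    have h1 := H _ ((e1 (n 1 - 1)).2 (by omega))
    have h2 := H _ ((e2 (n 2 - 1)).2 (by omega))
    have h3 := H _ ((e3 (n 3 - 1)).2 (by omega))
    rw [s0, e2] at h0
    rw [s1, e3] at h1
    rw [s2, e0] at h2
    rw [s3, e1] at h3
    omega
  · intro H z hz
    obtain ⟨x, rfl | rfl | rfl | rfl⟩ :
        ∃ x, z = 4 * x ∨ z = 4 * x + 1 ∨ z = 4 * x + 2 ∨ z = 4 * x + 3 := ⟨z / 4, by omega⟩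
    · rw [e0] at hz
      rw [s0, e2]
      omega
    · rw [e1] at hz
      rw [s1, e3]
      omega
    · rw [e2] at hz
      rw [s2, e0]
      omega
    · rw [e3] at hz
      rw [s3, e1]
      omega

/-! ### Parametrization of the cores by triples. -/

/-- The integer `c` with `2 c ^ 2 - c` equal to the `N`-th triangular number. -/
def triangularRoot (N : ℕ) : ℤ := if N % 2 = 0 then -(N / 2) else (N + 1) / 2

/-- The one of `k` and `-1 - k` with the parity of `c`. -/
def parityChoice (c : ℤ) (k : ℕ) : ℤ := if (c + k) % 2 = 0 then k else -1 - k

theorem two_mul_succ_choose_two (k : ℕ) : 2 * (k + 1).choose 2 = k ^ 2 + k := by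
  rw [Nat.choose_two_right, Nat.mul_div_cancel' (Nat.even_mul_pred_self _).two_dvd,
    Nat.add_sub_cancel]
  ring

theorem triangularRoot_spec (N : ℕ) :
    2 * triangularRoot N ^ 2 - triangularRoot N = ((N + 1).choose 2 : ℕ) := by
  have h := congrArg (Nat.cast (R := ℤ)) (two_mul_succ_choose_two N)
  push_cast at h
  obtain ⟨j, rfl | rfl⟩ := Nat.even_or_odd' N
  · have : triangularRoot (2 * j) = -j := by unfold triangularRoot; split_ifs <;> omega
    rw [this]
    push_cast at h ⊢
    linarith
  · have : triangularRoot (2 * j + 1) = j + 1 := by unfold triangularRoot; split_ifs <;> omega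
    rw [this]
    push_cast at h ⊢
    linarith

theorem parityChoice_spec (c : ℤ) (k : ℕ) :
    parityChoice c k ^ 2 + parityChoice c k = (2 * (k + 1).choose 2 : ℕ) := by
  rw [two_mul_succ_choose_two]
  unfold parityChoice
  split_ifs <;> push_cast <;> ring

theorem parityChoice_emod_two (c : ℤ) (k : ℕ) : (c + parityChoice c k) % 2 = 0 := by
  unfold parityChoice
  split_ifs <;> omega

theorem triangularRoot_injective : Function.Injective triangularRoot := by
  intro M N h
  unfold triangularRoot at h
  split_ifs at h <;> omega

theorem triangularRoot_surjective : Function.Surjective triangularRoot := by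
  intro c
  refine ⟨if 1 ≤ c then (2 * c - 1).toNat else (-2 * c).toNat, ?_⟩
  unfold triangularRoot
  split_ifs <;> omega

theorem parityChoice_injective (c : ℤ) : Function.Injective (parityChoice c) := by
  intro k l h
  unfold parityChoice at h
  split_ifs at h <;> omega

theorem exists_parityChoice_eq {c a : ℤ} (h : (c + a) % 2 = 0) {M : ℕ} (h₁ : -(M : ℤ) ≤ a)
    (h₂ : a < M) : ∃ k < M, parityChoice c k = a := by
  refine ⟨if 0 ≤ a then a.toNat else (-1 - a).toNat, ?_, ?_⟩
  · split_ifs <;> omega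
  · unfold parityChoice
    split_ifs <;> omega

theorem parityChoice_mem {c : ℤ} {k M : ℕ} (hk : k < M) :
    -(M : ℤ) ≤ parityChoice c k ∧ parityChoice c k < M := by
  unfold parityChoice
  split_ifs <;> omega

/-- The exponent contributed by a pair of summands and a triangular number. -/
def tripleWeight {M : ℕ} (t : (Fin M × Fin M) × ℕ) : ℕ :=
  2 * (t.1.1 + 1 : ℕ).choose 2 + 2 * (t.1.2 + 1 : ℕ).choose 2 + (t.2 + 1).choose 2

/-- The runner levels of the 4-core attached to a triple. -/
def runnerLevels {M : ℕ} (t : (Fin M × Fin M) × ℕ) : Fin 4 → ℤ :=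
  let c := triangularRoot t.2
  let a := parityChoice c t.1.1
  let b := parityChoice c t.1.2
  ![(c - a) / 2, (-c - b) / 2, (c + a) / 2, (b - c) / 2]

theorem runnerLevels_eq {M : ℕ} (t : (Fin M × Fin M) × ℕ) :
    let n := runnerLevels t
    n 0 + n 2 = triangularRoot t.2 ∧ n 1 + n 3 = -triangularRoot t.2 ∧
      n 2 - n 0 = parityChoice (triangularRoot t.2) t.1.1 ∧
      n 3 - n 1 = parityChoice (triangularRoot t.2) t.1.2 := by
  have ha := parityChoice_emod_two (triangularRoot t.2) t.1.1
  have hb := parityChoice_emod_two (triangularRoot t.2) t.1.2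
  simp only [runnerLevels, Matrix.cons_val]
  omega

theorem sum_runnerLevels {M : ℕ} (t : (Fin M × Fin M) × ℕ) : ∑ r, runnerLevels t r = 0 := by
  obtain ⟨h1, h2, -, -⟩ := runnerLevels_eq t
  rw [Fin.sum_univ_four]
  linarith

theorem size_runnerLevels {M : ℕ} (t : (Fin M × Fin M) × ℕ) :
    ∑ r : Fin 4, ((4 : ℕ) * runnerLevels t r ^ 2 + 2 * r * runnerLevels t r) =
      2 * (tripleWeight t : ℤ) := by
  obtain ⟨h1, h2, h3, h4⟩ := runnerLevels_eq t
  have hc := triangularRoot_spec t.2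
  have ha := parityChoice_spec (triangularRoot t.2) t.1.1
  have hb := parityChoice_spec (triangularRoot t.2) t.1.2
  rw [tripleWeight, Nat.cast_add, Nat.cast_add, ← hc, ← ha, ← hb, ← h3, ← h4]
  have h2' : runnerLevels t 3 = -triangularRoot t.2 - runnerLevels t 1 := by linarith
  rw [Fin.sum_univ_four, h2', ← h1]
  simp
  ring

theorem runnerLevels_injective {M : ℕ} :
    Function.Injective (runnerLevels : (Fin M × Fin M) × ℕ → Fin 4 → ℤ) := by
  rintro s t h
  obtain ⟨h1, h2, h3, h4⟩ := runnerLevels_eq s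
  obtain ⟨h1', h2', h3', h4'⟩ := runnerLevels_eq t
  rw [h] at h1 h3 h4
  have hN := triangularRoot_injective (h1.symm.trans h1')
  rw [← hN] at h3' h4'
  have hk := parityChoice_injective _ (h3.symm.trans h3')
  have hl := parityChoice_injective _ (h4.symm.trans h4')
  exact Prod.ext (Prod.ext (Fin.ext hk) (Fin.ext hl)) hN

/-- The inequalities say that `n 2 - n 0` and `n 3 - n 1` lie in `[-(m+2), m+1]`, the range of
`parityChoice` for `k < m + 2`. The parity condition is automatic, by the balance `hn`. -/
theorem exists_runnerLevels_eq_iff {m : ℕ} {n : Fin 4 → ℤ} (hn : ∑ r, n r = 0) :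
    (∃ t : (Fin (m + 2) × Fin (m + 2)) × ℕ, runnerLevels t = n) ↔
      (n 0 ≤ n 2 + m + 2 ∧ n 2 ≤ n 0 + m + 1) ∧ n 1 ≤ n 3 + m + 2 ∧ n 3 ≤ n 1 + m + 1 := by
  constructor
  · rintro ⟨t, rfl⟩
    obtain ⟨h1, h2, h3, h4⟩ := runnerLevels_eq t
    have ha := parityChoice_mem (c := triangularRoot t.2) t.1.1.2
    have hb := parityChoice_mem (c := triangularRoot t.2) t.1.2.2
    push_cast at ha hb
    omega
  · intro H
    rw [Fin.sum_univ_four] at hn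
    obtain ⟨N, hN⟩ := triangularRoot_surjective (n 0 + n 2)
    obtain ⟨k, hk, hk'⟩ := exists_parityChoice_eq (c := n 0 + n 2) (a := n 2 - n 0) (M := m + 2)
      (by omega) (by omega) (by omega)
    obtain ⟨l, hl, hl'⟩ := exists_parityChoice_eq (c := n 0 + n 2) (a := n 3 - n 1) (M := m + 2)
      (by omega) (by omega) (by omega)
    refine ⟨((⟨k, hk⟩, ⟨l, hl⟩), N), ?_⟩
    obtain ⟨h1, h2, h3, h4⟩ := runnerLevels_eq (M := m + 2) ((⟨k, hk⟩, ⟨l, hl⟩), N)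
    simp only [hN, hk', hl'] at h1 h2 h3 h4
    ext r
    fin_cases r <;> simp only [Fin.zero_eta, Fin.mk_one, Fin.reduceFinMk] <;> omega

theorem modCoreCount_four_eq (m n : ℕ) :
    modCoreCount 4 (4 * m + 2) n =
      Nat.card {t : (Fin (m + 2) × Fin (m + 2)) × ℕ // tripleWeight t = n} := by
  have hcore : ∀ p : n.Partition, p.IsModCore 4 (4 * m + 2) ↔
      ∃ t : (Fin (m + 2) × Fin (m + 2)) × ℕ,
        p.toYoungDiagram.maya = flushAbacus (runnerLevels t) := by
    intro p
    rw [Nat.Partition.isModCore_four_iff, Nat.Partition.isSimultaneousCore_iff (by simp)]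
    have h4 := YoungDiagram.sub_mem_maya_iff_exists_flushAbacus
      (μ := p.toYoungDiagram) four_pos
    simp only [Set.mem_insert_iff, Set.mem_singleton_iff, forall_eq_or_imp, forall_eq, h4]
    constructor
    · rintro ⟨⟨ν, hν⟩, h⟩
      have hsum := (YoungDiagram.sum_eq_zero_and_size_of_maya_eq four_pos hν).1
      rw [hν, sub_mem_flushAbacus_four_iff, ← exists_runnerLevels_eq_iff hsum] at h
      obtain ⟨t, rfl⟩ := h
      exact ⟨t, hν⟩
    · rintro ⟨t, ht⟩
      refine ⟨⟨_, ht⟩, ?_⟩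
      rw [ht, sub_mem_flushAbacus_four_iff, ← exists_runnerLevels_eq_iff (sum_runnerLevels t)]
      exact ⟨t, rfl⟩
  have hsize : ∀ (μ : YoungDiagram) (t : (Fin (m + 2) × Fin (m + 2)) × ℕ),
      μ.maya = flushAbacus (runnerLevels t) → μ.rowLens.sum = tripleWeight t := by
    intro μ t h
    have := (YoungDiagram.sum_eq_zero_and_size_of_maya_eq four_pos h).2
    rw [size_runnerLevels] at this
    omega
  have hex : ∀ p : {p : n.Partition // p.IsModCore 4 (4 * m + 2)},
      ∃ t : {t : (Fin (m + 2) × Fin (m + 2)) × ℕ // tripleWeight t = n},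
        p.1.toYoungDiagram.maya = flushAbacus (runnerLevels t.1) := by
    rintro ⟨p, hp⟩
    obtain ⟨t, ht⟩ := (hcore p).1 hp
    exact ⟨⟨t, (hsize _ t ht).symm.trans p.sum_rowLens_toYoungDiagram⟩, ht⟩
  -- `F` sends a core to the triple with the same Maya diagram. Injectivity of both encodings and
  -- the size formula make it a bijection.
  choose F hF using hex
  refine Nat.card_eq_of_bijective F ⟨fun p q h => ?_, fun t => ?_⟩
  · refine Subtype.ext (Nat.Partition.toYoungDiagram_injective (YoungDiagram.maya_injective ?_))
    rw [hF, hF, h]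
  · obtain ⟨μ, hμ⟩ := YoungDiagram.exists_maya_eq_flushAbacus four_pos (sum_runnerLevels t.1)
    obtain ⟨p, hp⟩ := Nat.Partition.exists_toYoungDiagram_eq ((hsize μ t.1 hμ).trans t.2)
    have hpμ : p.toYoungDiagram.maya = flushAbacus (runnerLevels t.1) := hp ▸ hμ
    refine ⟨⟨p, (hcore p).2 ⟨t.1, hpμ⟩⟩, Subtype.ext (runnerLevels_injective ?_)⟩
    exact flushAbacus_injective ((hF _).symm.trans hpμ)

/-! ### Generating functions. -/

/-- The generating function of a weight with finite fibres. -/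
theorem hasSum_X_pow_weight {ι : Type*} (w : ι → ℕ) (hw : ∀ n, {i | w i = n}.Finite) :
    HasSum (fun i => (X : ℚ⟦X⟧) ^ w i) (PowerSeries.mk fun n => (Nat.card {i // w i = n} : ℚ)) := by
  rw [PowerSeries.WithPiTopology.hasSum_iff_hasSum_coeff]
  intro n
  have hcard : Nat.card {i // w i = n} = (hw n).toFinset.card :=
    Nat.card_eq_card_finite_toFinset (hw n)
  rw [coeff_mk, hcard, Finset.cast_card]
  have h1 : ∑ i ∈ (hw n).toFinset, (1 : ℚ) = ∑ i ∈ (hw n).toFinset, coeff n ((X : ℚ⟦X⟧) ^ w i) :=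
    Finset.sum_congr rfl fun i hi => by
      rw [coeff_X_pow, if_pos ((hw n).mem_toFinset.1 hi).symm]
  rw [h1]
  refine hasSum_sum_of_ne_finset_zero fun i hi => ?_
  rw [coeff_X_pow, if_neg]
  exact fun h => hi ((hw n).mem_toFinset.2 h.symm)

theorem finite_tripleWeight_eq {M : ℕ} (n : ℕ) :
    {t : (Fin M × Fin M) × ℕ | tripleWeight t = n}.Finite := by
  refine (Set.finite_univ.prod (Set.finite_Iic n)).subset fun t ht => ⟨Set.mem_univ _, ?_⟩
  have h1 : tripleWeight t = n := ht
  have h2 : (t.2 + 1).choose 2 = t.2 + t.2.choose 2 := by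
    rw [Nat.choose_succ_succ' t.2 1, Nat.choose_one_right]
  rw [tripleWeight] at h1
  rw [Set.mem_Iic]
  omega

theorem modCoreGenFun_four_eq (m : ℕ) :
    modCoreGenFun 4 (4 * m + 2) = (∑' n : ℕ, (X : ℚ⟦X⟧) ^ ((n + 1).choose 2)) *
      (∑ k ∈ Finset.range (m + 2), (X : ℚ⟦X⟧) ^ (2 * (k + 1).choose 2)) ^ 2 := by
  have h := hasSum_X_pow_weight _ (finite_tripleWeight_eq (M := m + 2))
  have hfib : ∀ k : Fin (m + 2) × Fin (m + 2),
      HasSum (fun N : ℕ => (X : ℚ⟦X⟧) ^ tripleWeight (k, N))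
        (X ^ (2 * (k.1 + 1 : ℕ).choose 2) * X ^ (2 * (k.2 + 1 : ℕ).choose 2) *
          ∑' n : ℕ, (X : ℚ⟦X⟧) ^ ((n + 1).choose 2)) := by
    intro k
    simpa only [tripleWeight, pow_add] using summable_X_pow_choose.hasSum.mul_left
      ((X : ℚ⟦X⟧) ^ (2 * (k.1 + 1 : ℕ).choose 2) * X ^ (2 * (k.2 + 1 : ℕ).choose 2))
  -- Summing over `N` first leaves a finite sum over the pairs `(k, l)`, which is a square times the
  -- triangular series.
  have h2 := (h.prod_fiberwise hfib).unique (hasSum_fintype _)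
  simp only [modCoreGenFun, modCoreCount_four_eq, h2]
  rw [← Finset.sum_mul, mul_comm, sq, ← Fin.sum_univ_eq_sum_range
    (fun k => (X : ℚ⟦X⟧) ^ (2 * (k + 1).choose 2)), Finset.sum_mul_sum, Fintype.sum_prod_type]

theorem mainTheorem8 (m : ℕ) :
    modCoreGenFun 4 (4 * m + 2) =
        qPochhammerInf (X ^ 2) (X ^ 2) ^ 2 * (qPochhammerInf X X)⁻¹ *
          (∑ k ∈ Finset.range (m + 2), (X : ℚ⟦X⟧) ^ (k ^ 2 + k)) ^ 2 ∧
      modCoreGenFun 4 (4 * m + 2) =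
        (∑' n : ℕ, (X : ℚ⟦X⟧) ^ ((n + 1).choose 2)) *
          (∑ k ∈ Finset.range (m + 2), (X : ℚ⟦X⟧) ^ (2 * (k + 1).choose 2)) ^ 2 ∧
      ∀ (n : ℕ) (p : n.Partition),
        p.IsModCore 4 (4 * m + 2) ↔ p.IsSimultaneousCore {4, 4 * m + 6} := by
  refine ⟨?_, modCoreGenFun_four_eq m, fun n p => p.isModCore_four_iff m⟩
  have hne : constantCoeff (qPochhammerInf X X) ≠ 0 := by
    have := constantCoeff_qPochhammerInf 1 le_rfl
    rw [pow_one] at this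
    rw [this]
    exact one_ne_zero
  rw [modCoreGenFun_four_eq, ← qPochhammerInf_mul_tsum_X_pow_choose,
    mul_right_comm (qPochhammerInf X X),
    PowerSeries.mul_inv_cancel _ hne, one_mul]
  simp only [two_mul_succ_choose_two]
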